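/- Let $\mathcal X$ be a measurable space, let $\Theta\subset\mathbb R$ be convex, and let $\{P_\theta\}_{\theta\in\Theta}$ be a family of probability distributions on $\mathcal X$. Let $\theta_0\in\Theta$, $r>0$ and $0<M<\infty$ be such that $[\theta_0,\theta_0+r]\subset\Theta$ and $$\mathrm{KL}\big(P_{\theta}\,\|\,P_{\theta+\delta}\big)\le M\delta^2\qquad\text{for all }\theta\text{ and }\delta\ge 0\text{ with }\theta_0\le\theta\le\theta+\delta\le\theta_0+r .$$ Let $\alpha\in[0,1]$ and $t:\mathbb N\to\mathbb R_+$, where $\mathbb N=\{1,2,\dots\}$. A sequence of estimators $\hat\theta_n:\mathcal X^n\to\mathbb R$ (measurable) is called an $(\alpha,t(\cdot))$-estimator if for every $\theta\in\Theta$, when $X_1,X_2,\dots$ are i.i.d. from $P_\theta$, $$\mathbb P\big(|\hat\theta_n(X_1,\dots,X_n)-\theta|\le t(n)\ \text{ for all } n\in\mathbb N\big)\ge 1-\alpha .$$ If an $(\alpha,t(\cdot))$-estimator sequence exists, then $$t(n)\ \ge\ \sqrt{\frac{1-\alpha}{8M}}\,\sqrt{\frac{\log\log n}{n}}\qquad\text{for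 infinitely many } n .$$ -/

import Mathlib

open MeasureTheory Filter
open scoped NNReal ENNReal

/-- Let `(P i)` be a family of probability distributions on `𝒳`, indexed by `ι`, and let `θ i` be
the real parameter of `P i`. A sequence of estimators `est`, where `est n` is a (measurable)
function of the first `n` observations, is an `(α, t(·))`-estimator if for every member `P i` of
the family, when `X₀, X₁, …` are i.i.d. from `P i` (that is, when the sequence is drawn from the
infinite product measure), with probability at least `1 - α` the bound
`|est n (X₀, …, X_{n-1}) - θ i| ≤ t n` holds simultaneously for all sample sizes `n ≥ 1`. -/
structure IsTimeUniformEstimator {𝒳 : Type*} [MeasurableSpace 𝒳] {ι : Type*}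
    (P : ι → ProbabilityMeasure 𝒳) (θ : ι → ℝ) (α : ℝ) (t : ℕ → ℝ≥0)
    (est : (n : ℕ) → (Fin n → 𝒳) → ℝ) : Prop where
  measurable : ∀ n, 1 ≤ n → Measurable (est n)
  coverage : ∀ i,
    ENNReal.ofReal (1 - α) ≤
      Measure.infinitePi (fun _ : ℕ => (P i : Measure 𝒳))
        {x | ∀ n, 1 ≤ n → |est n (fun j : Fin n => x j) - θ i| ≤ t n}

/-! Suppose the bound fails for all large `n`. Along sample sizes `m j = 32 ^ j`, let `s j` be the
claimed bound and put `θ j` at distance `2√2 * s j` below `θ₀ + r`. Let `E j` say that for `J ≤ i ≤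
j` the estimate at `m i` is `s i`-close to `θ j`. Under `θ j` it has probability at least `β = 1 -
α`. The first `m j` observations decide `E j`, and the KL divergence of their law under `θ j` from
that under `θ₀ + r` is at most `β log log (m j)`. Change of measure (`exp_neg_le_infinitePi_real`)
then gives `E j` probability at least a constant over `j` under `θ₀ + r`. The `E j` are disjoint,
since the `θ j` are well separated, so divergence of the harmonic series contradicts total mass one.
-/

open InformationTheory in
/-- Fenchel–Young inequality for `klFun`. -/
lemma mul_sub_exp_le_klFun {x : ℝ} (hx : 0 ≤ x) (a : ℝ) :
    a * x - (Real.exp a - 1) ≤ klFun x := by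
  rw [klFun_apply]
  rcases hx.eq_or_lt with rfl | hx
  · simp [(Real.exp_pos a).le]
  · have h := Real.add_one_le_exp (a - Real.log x)
    rw [Real.exp_sub, Real.exp_log hx, le_div_iff₀ hx] at h
    linarith

open InformationTheory in
/-- Change of measure: an event of `μ`-probability at least `β` has `ν`-probability at least
`exp (-(KL(μ ‖ ν) + 1) / β)`. -/
lemma exp_neg_le_measureReal_of_klDiv_le {Ω : Type*} [MeasurableSpace Ω] {μ ν : Measure Ω}
    [IsFiniteMeasure μ] [IsFiniteMeasure ν] {K β : ℝ} (hK : 0 ≤ K) (hβ : 0 < β)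
    (hμν : klDiv μ ν ≤ ENNReal.ofReal K) {F : Set Ω}
    (hβF : β ≤ μ.real F) :
    Real.exp (-((K + 1) / β)) ≤ ν.real F := by
  obtain ⟨hac, hint⟩ := klDiv_ne_top_iff.mp (ne_top_of_le_ne_top ENNReal.ofReal_ne_top hμν)
  -- Integrating Fenchel–Young over `F` gives `a μ(F) - (exp a - 1) ν(F) ≤ K`; this `a` makes the
  -- first term at least `K + 1`, which leaves `1 ≤ exp a * ν(F)`.
  set a := (K + 1) / β with ha
  have ha0 : 0 ≤ a := by positivity
  have hi : Integrable (fun x ↦ klFun (μ.rnDeriv ν x).toReal) ν :=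
    (integrable_klFun_rnDeriv_iff hac).mpr hint
  have h1 : ∫ x in F, klFun (μ.rnDeriv ν x).toReal ∂ν ≤ K := by
    calc _ ≤ ∫ x, klFun (μ.rnDeriv ν x).toReal ∂ν :=
          setIntegral_le_integral hi (ae_of_all _ fun _ ↦ klFun_nonneg ENNReal.toReal_nonneg)
      _ = (klDiv μ ν).toReal := (toReal_klDiv_eq_integral_klFun hac).symm
      _ ≤ K := ENNReal.toReal_le_of_le_ofReal hK hμν
  have hr : IntegrableOn (fun x ↦ a * (μ.rnDeriv ν x).toReal) F ν :=
    (Measure.integrable_toReal_rnDeriv.const_mul a).integrableOn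
  have h2 : ∫ x in F, (a * (μ.rnDeriv ν x).toReal - (Real.exp a - 1)) ∂ν ≤
      ∫ x in F, klFun (μ.rnDeriv ν x).toReal ∂ν :=
    integral_mono (hr.sub (integrable_const _)) hi.integrableOn
      fun x ↦ mul_sub_exp_le_klFun ENNReal.toReal_nonneg a
  rw [integral_sub hr (integrable_const _), integral_const_mul,
    Measure.setIntegral_toReal_rnDeriv hac, setIntegral_const, smul_eq_mul] at h2
  have h3 : K + 1 ≤ a * μ.real F := by
    calc K + 1 = a * β := by rw [ha]; field_simp
      _ ≤ _ := by gcongr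
  have h4 : 1 ≤ ν.real F * Real.exp a := by
    nlinarith [measureReal_nonneg (μ := ν) (s := F)]
  rw [Real.exp_neg, inv_eq_one_div, div_le_iff₀ (Real.exp_pos a)]
  exact h4

-- Chain rule for constant kernels; data processing under the swap moves the differing second factor
-- into first place.
open InformationTheory in
lemma klDiv_prod_le {Ω Ω' : Type*} [MeasurableSpace Ω] [MeasurableSpace Ω']
    (μ ν : Measure Ω) (μ' ν' : Measure Ω') [IsProbabilityMeasure μ] [IsProbabilityMeasure ν]
    [IsProbabilityMeasure μ'] [IsProbabilityMeasure ν'] :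
    klDiv (μ.prod μ') (ν.prod ν') ≤ klDiv μ ν + klDiv μ' ν' := by
  have h : klDiv (μ.prod μ') (ν.prod ν') = klDiv μ ν + klDiv (μ.prod μ') (μ.prod ν') := by
    simp only [← Measure.compProd_const]
    exact klDiv_compProd_eq_add _ _ _ _
  have h' : klDiv (μ.prod μ') (μ.prod ν') ≤ klDiv (μ'.prod μ) (ν'.prod μ) := by
    rw [← Measure.prod_swap (μ := μ'), ← Measure.prod_swap (μ := ν')]
    exact klDiv_map_le _ _ measurable_swap
  have h'' : klDiv (μ'.prod μ) (ν'.prod μ) = klDiv μ' ν' := by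
    simp only [← Measure.compProd_const]
    exact klDiv_compProd_left _ _ _
  rw [h]
  gcongr
  exact h'.trans h''.le

open InformationTheory in
lemma klDiv_pi_const_le {Ω : Type*} [MeasurableSpace Ω] (μ ν : Measure Ω)
    [IsProbabilityMeasure μ] [IsProbabilityMeasure ν] (n : ℕ) :
    klDiv (Measure.pi fun _ : Fin n ↦ μ) (Measure.pi fun _ : Fin n ↦ ν) ≤ n * klDiv μ ν := by
  induction n with
  | zero => rw [Measure.pi_of_empty, Measure.pi_of_empty]; simp [klDiv_self]
  | succ n ih =>
    have e (ρ : Measure Ω) [IsProbabilityMeasure ρ] :=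
      (measurePreserving_piFinSuccAbove (fun _ : Fin (n + 1) ↦ ρ) 0).symm.map_eq
    rw [← e μ, ← e ν]
    refine (klDiv_map_le _ _ (MeasurableEquiv.measurable _)).trans ((klDiv_prod_le _ _ _ _).trans ?_)
    push_cast
    rw [add_mul, one_mul, add_comm]
    gcongr

lemma infinitePi_map_fin {Ω : Type*} [MeasurableSpace Ω] (μ : Measure Ω)
    [IsProbabilityMeasure μ] (n : ℕ) :
    (Measure.infinitePi fun _ : ℕ ↦ μ).map (fun x (j : Fin n) ↦ x j) =
      Measure.pi fun _ : Fin n ↦ μ := by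
  refine (Measure.pi_eq fun s hs ↦ ?_).symm
  rw [Measure.map_apply (by fun_prop) (.univ_pi hs)]
  let t : ℕ → Set Ω := fun i ↦ if h : i < n then s ⟨i, h⟩ else Set.univ
  have ht (i : ℕ) : MeasurableSet (t i) := by
    by_cases h : i < n <;> simp [t, h, hs]
  have : (fun (x : ℕ → Ω) (j : Fin n) ↦ x j) ⁻¹' Set.univ.pi s =
      Set.pi (Finset.range n : Finset ℕ) t := by
    ext x
    simp only [Set.mem_preimage, Set.mem_pi, Finset.coe_range, Set.mem_Iio, t]
    exact ⟨fun h i hi ↦ by simpa [hi] using h ⟨i, hi⟩,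
      fun h i ↦ by simpa using h i i.2⟩
  rw [this, Measure.infinitePi_pi _ fun i _ ↦ ht i, Finset.prod_range]
  simp [t]

open InformationTheory in
/-- Change of measure for an i.i.d. sequence and an event that depends on the first `n` terms. -/
lemma exp_neg_le_infinitePi_real {Ω : Type*} [MeasurableSpace Ω] {μ ν : Measure Ω}
    [IsProbabilityMeasure μ] [IsProbabilityMeasure ν] {n : ℕ} {K β : ℝ} (hK : 0 ≤ K) (hβ : 0 < β)
    (hμν : n * klDiv μ ν ≤ ENNReal.ofReal K) {S : Set (Fin n → Ω)} (hS : MeasurableSet S)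
    (hβS : β ≤ (Measure.infinitePi fun _ : ℕ ↦ μ).real ((fun x (j : Fin n) ↦ x j) ⁻¹' S)) :
    Real.exp (-((K + 1) / β)) ≤
      (Measure.infinitePi fun _ : ℕ ↦ ν).real ((fun x (j : Fin n) ↦ x j) ⁻¹' S) := by
  have e (ρ : Measure Ω) [IsProbabilityMeasure ρ] :
      (Measure.infinitePi fun _ : ℕ ↦ ρ).real ((fun x (j : Fin n) ↦ x j) ⁻¹' S) =
        (Measure.pi fun _ : Fin n ↦ ρ).real S := by
    rw [← infinitePi_map_fin, map_measureReal_apply (by fun_prop) hS]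
  rw [e] at hβS ⊢
  exact exp_neg_le_measureReal_of_klDiv_le hK hβ ((klDiv_pi_const_le μ ν n).trans hμν) hβS

lemma two_le_log_thirty_two : 2 ≤ Real.log 32 := by
  have : (32 : ℝ) = 2 ^ 5 := by norm_num
  rw [this, Real.log_pow]
  have := Real.log_two_gt_d9
  norm_num
  linarith

/-- The law-of-the-iterated-logarithm rate along sample sizes `32 ^ j`, up to a constant. -/
noncomputable def lilRate (j : ℕ) : ℝ :=
  Real.sqrt (Real.log (Real.log ((32 ^ j : ℕ) : ℝ)) / ((32 ^ j : ℕ) : ℝ))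

lemma log_thirty_two_pow (j : ℕ) : Real.log ((32 ^ j : ℕ) : ℝ) = j * Real.log 32 := by
  push_cast
  rw [Real.log_pow]

lemma two_le_log_thirty_two_pow {j : ℕ} (hj : 1 ≤ j) : 2 ≤ Real.log ((32 ^ j : ℕ) : ℝ) := by
  rw [log_thirty_two_pow]
  have h : (1 : ℝ) ≤ j := by exact_mod_cast hj
  nlinarith [two_le_log_thirty_two]

/-- One step at most squares `log n`, so `log log n` at most doubles while `n` grows 32-fold; the
ratio under the root falls by at least 16. -/
lemma lilRate_succ_le {j : ℕ} (hj : 1 ≤ j) : lilRate (j + 1) ≤ lilRate j / 4 := by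
  have h2 := two_le_log_thirty_two_pow hj
  have hj' : (1 : ℝ) ≤ j := by exact_mod_cast hj
  have h : Real.log (Real.log ((32 ^ (j + 1) : ℕ) : ℝ)) ≤
      2 * Real.log (Real.log ((32 ^ j : ℕ) : ℝ)) := by
    rw [← Nat.cast_two, ← Real.log_pow]
    refine Real.log_le_log (by linarith [two_le_log_thirty_two_pow (j := j + 1) (by omega)]) ?_
    rw [log_thirty_two_pow] at h2 ⊢
    rw [log_thirty_two_pow]
    push_cast
    nlinarith [two_le_log_thirty_two]
  unfold lilRate
  rw [show (4 : ℝ) = Real.sqrt 16 by rw [show (16 : ℝ) = 4 ^ 2 by norm_num]; simp,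
    ← Real.sqrt_div' _ (by norm_num)]
  apply Real.sqrt_le_sqrt
  rw [div_div, div_le_div_iff₀ (by positivity) (by positivity)]
  push_cast [pow_succ] at h ⊢
  have : (0 : ℝ) < 32 ^ j := by positivity
  nlinarith

lemma lilRate_le_div_four {i j : ℕ} (hi : 1 ≤ i) (hij : i < j) :
    lilRate j ≤ lilRate i / 4 := by
  induction j, hij using Nat.le_induction with
  | base => exact lilRate_succ_le hi
  | succ k hk ih =>
    have := lilRate_succ_le (j := k) (by omega)
    have : 0 ≤ lilRate k := Real.sqrt_nonneg _
    linarith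

lemma tendsto_lilRate : Tendsto lilRate atTop (nhds 0) := by
  rw [← tendsto_add_atTop_iff_nat 1]
  have h (j : ℕ) : lilRate (j + 1) ≤ lilRate 1 * (1 / 4) ^ j := by
    induction j with
    | zero => simp
    | succ j ih =>
      have := lilRate_succ_le (j := j + 1) (by omega)
      rw [pow_succ]
      linarith
  refine squeeze_zero (fun j ↦ Real.sqrt_nonneg _) h ?_
  simpa using (tendsto_pow_atTop_nhds_zero_of_lt_one (r := (1 / 4 : ℝ))
    (by norm_num) (by norm_num)).const_mul (lilRate 1)

/-- The events that the estimates at sample sizes `m i`, `J ≤ i ≤ j`, are `s i`-close to `θ j`. -/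
def closeEvent {𝒳 : Type*} (est : (n : ℕ) → (Fin n → 𝒳) → ℝ) (m : ℕ → ℕ) (s θ : ℕ → ℝ)
    (J j : ℕ) : Set (ℕ → 𝒳) :=
  {x | ∀ i ∈ Finset.Icc J j, |est (m i) (fun k ↦ x k) - θ j| < s i}

lemma exists_preimage_eq_closeEvent {𝒳 : Type*} [MeasurableSpace 𝒳]
    {est : (n : ℕ) → (Fin n → 𝒳) → ℝ} {m : ℕ → ℕ} (hm : Monotone m) (s θ : ℕ → ℝ) (J j : ℕ)
    (hest : ∀ i, Measurable (est (m i))) :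
    ∃ S : Set (Fin (m j) → 𝒳), MeasurableSet S ∧
      (fun x (k : Fin (m j)) ↦ x k) ⁻¹' S = closeEvent est m s θ J j := by
  refine ⟨⋂ i, ⋂ h : i ∈ Finset.Icc J j,
    {y | |est (m i) (fun k ↦ y (k.castLE (hm (Finset.mem_Icc.mp h).2))) - θ j| < s i},
    .iInter fun i ↦ .iInter fun h ↦ ?_, ?_⟩
  · refine measurableSet_lt ?_ measurable_const
    exact (((hest i).comp (by fun_prop)).sub_const _).abs
  · ext x
    simp [closeEvent]

lemma measurableSet_closeEvent {𝒳 : Type*} [MeasurableSpace 𝒳]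
    {est : (n : ℕ) → (Fin n → 𝒳) → ℝ} {m : ℕ → ℕ} (hm : Monotone m) (s θ : ℕ → ℝ) (J j : ℕ)
    (hest : ∀ i, Measurable (est (m i))) : MeasurableSet (closeEvent est m s θ J j) := by
  obtain ⟨S, hS, h⟩ := exists_preimage_eq_closeEvent hm s θ J j hest
  rw [← h]
  exact hS.preimage (by fun_prop)

/-- Both events constrain the same estimate, the one at sample size `m i`. -/
lemma disjoint_closeEvent {𝒳 : Type*} (est : (n : ℕ) → (Fin n → 𝒳) → ℝ) (m : ℕ → ℕ)
    {s θ : ℕ → ℝ} {J i j : ℕ} (hJ : J ≤ i) (hij : i ≤ j) (h : 2 * s i ≤ |θ i - θ j|) :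
    Disjoint (closeEvent est m s θ J i) (closeEvent est m s θ J j) := by
  refine Set.disjoint_left.mpr fun x hi hj ↦ ?_
  have h1 := hi i (Finset.mem_Icc.mpr ⟨hJ, le_rfl⟩)
  have h2 := hj i (Finset.mem_Icc.mpr ⟨hJ, hij⟩)
  have := abs_sub_le (θ i) (est (m i) fun k ↦ x k) (θ j)
  rw [abs_sub_comm (θ i) (est _ _)] at this
  linarith

lemma not_summable_const_div_add {c : ℝ} (hc : c ≠ 0) (J : ℕ) :
    ¬ Summable fun k : ℕ ↦ c / ((J + k : ℕ) : ℝ) := by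
  intro h
  have h' : Summable fun k : ℕ ↦ c * ((k : ℝ))⁻¹ := by
    rw [← summable_nat_add_iff J]
    simpa [div_eq_mul_inv, add_comm] using h
  exact Real.not_summable_natCast_inv ((summable_mul_left_iff hc).mp h')

theorem proposition3 {𝒳 : Type*} [MeasurableSpace 𝒳]
    (Θ : Set ℝ) (hΘ : Convex ℝ Θ) (P : Θ → ProbabilityMeasure 𝒳)
    (θ₀ r M : ℝ) (hr : 0 < r) (hM : 0 < M)
    (hsub : Set.Icc θ₀ (θ₀ + r) ⊆ Θ)
    (hKL : ∀ θ θ' : Θ, θ₀ ≤ (θ : ℝ) → (θ : ℝ) ≤ θ' → (θ' : ℝ) ≤ θ₀ + r →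
      InformationTheory.klDiv (P θ : Measure 𝒳) (P θ' : Measure 𝒳) ≤
        ENNReal.ofReal (M * ((θ' : ℝ) - θ) ^ 2))
    (α : ℝ) (hα : α ∈ Set.Icc (0 : ℝ) 1) (t : ℕ → ℝ≥0)
    (est : (n : ℕ) → (Fin n → 𝒳) → ℝ)
    (hest : IsTimeUniformEstimator P (fun θ : Θ => (θ : ℝ)) α t est) :
    ∃ᶠ n : ℕ in atTop,
      Real.sqrt ((1 - α) / (8 * M)) * Real.sqrt (Real.log (Real.log n) / n) ≤ t n := by
  obtain ⟨-, hα1⟩ := hα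
  rcases hα1.eq_or_lt with rfl | hα1
  · exact Eventually.frequently (.of_forall fun n ↦ by simp)
  by_contra hcon
  rw [not_frequently] at hcon
  set β := 1 - α with hβ
  have hβ0 : 0 < β := by linarith
  set m : ℕ → ℕ := fun j ↦ 32 ^ j with hm
  have hm_mono : Monotone m := fun i j h ↦ Nat.pow_le_pow_right (by norm_num) h
  have hm_one (j : ℕ) : 1 ≤ m j := Nat.one_le_pow _ _ (by norm_num)
  set c := Real.sqrt (β / (8 * M)) with hc
  have hc0 : 0 ≤ c := Real.sqrt_nonneg _
  set s : ℕ → ℝ := fun j ↦ c * lilRate j with hs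
  have hs0 (j : ℕ) : 0 ≤ s j := mul_nonneg hc0 (Real.sqrt_nonneg _)
  have hs_tendsto : Tendsto (fun j ↦ 2 * Real.sqrt 2 * s j) atTop (nhds 0) := by
    simpa using (tendsto_lilRate.const_mul c).const_mul (2 * Real.sqrt 2)
  have hm_tendsto : Tendsto m atTop atTop := tendsto_pow_atTop_atTop_of_one_lt (by norm_num)
  obtain ⟨J, hJ⟩ := eventually_atTop.mp <| ((hm_tendsto.eventually hcon).and
    (hs_tendsto.eventually_le_const hr)).and (eventually_ge_atTop 1)
  have hts (j : ℕ) (hj : J ≤ j) : (t (m j) : ℝ) < s j := not_le.mp (hJ j hj).1.1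
  have hδr (j : ℕ) (hj : J ≤ j) : 2 * Real.sqrt 2 * s j ≤ r := (hJ j hj).1.2
  have hJ1 : 1 ≤ J := (hJ J le_rfl).2
  have hδ0 (j : ℕ) : 0 ≤ 2 * Real.sqrt 2 * s j := mul_nonneg (by positivity) (hs0 j)
  -- The square of `2√2` cancels the 8 in `c`, and `2√2 * (1 - 1/4) ≥ 2` gives the separation.
  -- Approaching from below suits the one-sided KL hypothesis.
  set θ : ℕ → ℝ := fun j ↦ θ₀ + r - 2 * Real.sqrt 2 * s j with hθ
  have hθmem (j : ℕ) (hj : J ≤ j) : θ j ∈ Θ :=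
    hsub ⟨by simp only [hθ]; linarith [hδr j hj], by simp only [hθ]; linarith [hδ0 j]⟩
  let Q : Measure (ℕ → 𝒳) :=
    Measure.infinitePi fun _ ↦ (P ⟨θ₀ + r, hsub ⟨by linarith, le_rfl⟩⟩ : Measure 𝒳)
  have hmeas (i : ℕ) : Measurable (est (m i)) := hest.measurable _ (hm_one i)
  have hsqrt2 : 1.4 ≤ Real.sqrt 2 := Real.le_sqrt_of_sq_le (by norm_num)
  have hdisj {i j : ℕ} (hi : J ≤ i) (hij : i < j) :
      Disjoint (closeEvent est m s θ J i) (closeEvent est m s θ J j) := by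
    refine disjoint_closeEvent est m hi hij.le (le_trans ?_ (neg_le_abs _))
    have h1 : s j ≤ s i / 4 := by
      simp only [hs]
      rw [mul_div_assoc]
      exact mul_le_mul_of_nonneg_left (lilRate_le_div_four (hJ1.trans hi) hij) hc0
    simp only [hθ]
    nlinarith [hs0 i, mul_le_mul_of_nonneg_left h1 (Real.sqrt_nonneg 2)]
  have hlower (j : ℕ) (hj : J ≤ j) :
      Real.exp (-(1 / β)) / Real.log 32 / (j : ℝ) ≤ Q.real (closeEvent est m s θ J j) := by
    obtain ⟨S, hS, hSeq⟩ := exists_preimage_eq_closeEvent hm_mono s θ J j hmeas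
    have hlog := two_le_log_thirty_two_pow (hJ1.trans hj)
    have hLL : 0 ≤ Real.log (Real.log (m j : ℝ)) := Real.log_nonneg (by linarith)
    have hm0 : (0 : ℝ) < m j := by exact_mod_cast hm_one j
    have hkl : (m j : ℝ≥0∞) * InformationTheory.klDiv (P ⟨θ j, hθmem j hj⟩ : Measure 𝒳)
        (P ⟨θ₀ + r, hsub ⟨by linarith, le_rfl⟩⟩ : Measure 𝒳) ≤
          ENNReal.ofReal (β * Real.log (Real.log (m j : ℝ))) := by
      have h := hKL ⟨θ j, hθmem j hj⟩ ⟨θ₀ + r, hsub ⟨by linarith, le_rfl⟩⟩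
        (by simp only [hθ]; linarith [hδr j hj]) (by simp only [hθ]; linarith [hδ0 j]) le_rfl
      refine (mul_le_mul_right h _).trans (le_of_eq ?_)
      rw [← ENNReal.ofReal_natCast, ← ENNReal.ofReal_mul hm0.le]
      congr 1
      simp only [hθ, hs, sub_sub_cancel, mul_pow, lilRate, hc]
      rw [Real.sq_sqrt (by positivity), Real.sq_sqrt (by positivity),
        Real.sq_sqrt (div_nonneg hLL hm0.le)]
      change (m j : ℝ) * (M * (2 ^ 2 * 2 * (β / (8 * M) *
        (Real.log (Real.log (m j : ℝ)) / (m j : ℝ))))) = _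
      field_simp
      ring
    have hcov : β ≤ (Measure.infinitePi fun _ : ℕ ↦ (P ⟨θ j, hθmem j hj⟩ : Measure 𝒳)).real
        ((fun x (k : Fin (m j)) ↦ x k) ⁻¹' S) := by
      rw [hSeq, measureReal_def, ← ENNReal.ofReal_le_iff_le_toReal (measure_ne_top _ _)]
      refine (hest.coverage ⟨θ j, hθmem j hj⟩).trans (measure_mono fun x hx i hi ↦ ?_)
      exact (hx (m i) (hm_one i)).trans_lt (hts i (Finset.mem_Icc.mp hi).1)
    have h := exp_neg_le_infinitePi_real (by positivity) hβ0 hkl hS hcov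
    rw [hSeq] at h
    -- The factor `β` in the KL bound cancels the `1 / β` from the change of measure, leaving `exp
    -- (-1/β) / log (m j)` with `log (m j) = j * log 32`.
    refine le_trans (le_of_eq ?_) h
    rw [add_div, mul_div_cancel_left₀ _ hβ0.ne', neg_add, add_comm, Real.exp_add,
      Real.exp_neg (Real.log _), Real.exp_log (by linarith), log_thirty_two_pow, mul_inv]
    field_simp
  refine not_summable_const_div_add (c := Real.exp (-(1 / β)) / Real.log 32)
    (by have := two_le_log_thirty_two; positivity) J ?_
  refine summable_of_sum_range_le (c := 1) (fun k ↦ ?_) fun n ↦ ?_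
  · have := two_le_log_thirty_two
    positivity
  calc _ ≤ ∑ k ∈ Finset.range n, Q.real (closeEvent est m s θ J (J + k)) :=
        Finset.sum_le_sum fun k _ ↦ hlower _ (by omega)
    _ = Q.real (⋃ k ∈ Finset.range n, closeEvent est m s θ J (J + k)) := by
        refine (measureReal_biUnion_finset (fun a _ b _ hab ↦ ?_) fun k _ ↦
          measurableSet_closeEvent hm_mono s θ J _ hmeas).symm
        rcases hab.lt_or_gt with h | h
        · exact hdisj (by omega) (by omega)
        · exact (hdisj (by omega) (by omega)).symm
    _ ≤ 1 := measureReal_le_one
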